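/- Let $K$ be an algebraically closed field of characteristic zero, and let $f\in K[x_1,x_2,x_3]$ be an irreducible polynomial defining a surface $V=\{f=0\}\subset K^3$ that is not cylindrical (there is no nonzero vector $a\in K^3$ such that $x+ta\in V$ for all $x\in V$, $t\in K$). Assume that $V$ is translational, that is, $V$ has a rational parametrization (the Zariski closure of the image is $V$) of the form $P_1(t_1)+P_2(t_2)$ with $P_i\in K(t_i)^3\setminus K^3$ for $i=1,2$. Call such a pair $(P_1,P_2)$ normalized if $P_1$ and $P_2$ are both proper (that is, birational onto the curves they parametrize) and $P_2$ is defined at $0$ with $P_2(0)=(0,0,0)$ and $P_2'(0)\neq(0,0,0)$. For $a=(a_1,a_2,a_3)\in K^3$ put $g_a=a_1f_{x_1}+a_2f_{x_2}+a_3f_{x_3}$. Then there exist a vector $a\in K^3\setminus\{(0,0,0)\}$ and a normalized pair $(P_1,P_2)$ with $V$ parametrized by $P_1(t_1)+P_2(t_2)$ and $P_2'(0)=a$, such that the equations $f=g_a=0$ define a space curve (a nonempty algebraic subset of $K^3$ all of whose irreducible components are one-dimensional) and $P_1$ is a proper parametrization of an irreducible component $C_1$ of this curve. Moreover, this conclusion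 holds with $a=P_2'(0)$ for every normalized pair $(P_1,P_2)$ such that $P_1(t_1)+P_2(t_2)$ parametrizes $V$. -/

import Mathlib

open MvPolynomial

noncomputable section

/-- The algebraic set in affine `3`-space of the common zeros of a set of polynomials. -/
def zeroSet {K : Type*} [Field K] (S : Set (MvPolynomial (Fin 3) K)) : Set (Fin 3 → K) :=
  {x | ∀ p ∈ S, eval x p = 0}

/-- The Zariski closure of a set of points of affine `3`-space. -/
def zariskiClosure {K : Type*} [Field K] (S : Set (Fin 3 → K)) : Set (Fin 3 → K) :=
  zeroLocus K (vanishingIdeal K S)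

/-- The surface `f = 0` is cylindrical: it is invariant under all translations in some fixed
nonzero direction `a`, i.e. it is a union of parallel lines. -/
def IsCylindrical {K : Type*} [Field K] (f : MvPolynomial (Fin 3) K) : Prop :=
  ∃ a : Fin 3 → K, a ≠ 0 ∧ ∀ x : Fin 3 → K, eval x f = 0 → ∀ t : K, eval (x + t • a) f = 0

/-- The directional derivative `a₁ f_{x₁} + a₂ f_{x₂} + a₃ f_{x₃}`. -/
def dirDeriv {K : Type*} [Field K] (a : Fin 3 → K) (f : MvPolynomial (Fin 3) K) :
    MvPolynomial (Fin 3) K :=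
  ∑ i, C (a i) * pderiv i f

/-- No coordinate of the triple `P ∈ K(t)³` has a pole at the parameter value `s`. -/
def DefinedAt {K : Type*} [Field K] (P : Fin 3 → RatFunc K) (s : K) : Prop :=
  ∀ i, (P i).denom.eval s ≠ 0

/-- The value `P(s) ∈ K³` (meaningful if `P` is defined at `s`). -/
def valueAt {K : Type*} [Field K] (P : Fin 3 → RatFunc K) (s : K) : Fin 3 → K :=
  fun i => (P i).eval (RingHom.id K) s

/-- The value `P'(s) ∈ K³` of the derivative, by the quotient rule
(meaningful if `P` is defined at `s`). -/
def derivAt {K : Type*} [Field K] (P : Fin 3 → RatFunc K) (s : K) : Fin 3 → K :=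
  fun i => ((P i).num.derivative.eval s * (P i).denom.eval s
    - (P i).num.eval s * (P i).denom.derivative.eval s) / (P i).denom.eval s ^ 2

/-- `P` is a triple of constants, i.e. lies in `K³`. -/
def IsConstant {K : Type*} [Field K] (P : Fin 3 → RatFunc K) : Prop :=
  ∃ c : Fin 3 → K, ∀ i, P i = RatFunc.C (c i)

/-- The points `P(s)`, for the parameter values `s` at which `P` is defined. -/
def curveImage {K : Type*} [Field K] (P : Fin 3 → RatFunc K) : Set (Fin 3 → K) :=
  {x | ∃ s : K, DefinedAt P s ∧ x = valueAt P s}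

/-- The points `P₁(s) + P₂(t)`, for the parameter values at which both are defined. -/
def sumImage {K : Type*} [Field K] (P₁ P₂ : Fin 3 → RatFunc K) : Set (Fin 3 → K) :=
  {x | ∃ s t : K, DefinedAt P₁ s ∧ DefinedAt P₂ t ∧ x = valueAt P₁ s + valueAt P₂ t}

/-- `P₁(t₁) + P₂(t₂)`, with `P₁` and `P₂` nonconstant, is a rational parametrization of the
surface `f = 0`: the surface is the Zariski closure of the image. -/
structure IsTranslationalParam {K : Type*} [Field K] (f : MvPolynomial (Fin 3) K)
    (P₁ P₂ : Fin 3 → RatFunc K) : Prop where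
  nonconst₁ : ¬ IsConstant P₁
  nonconst₂ : ¬ IsConstant P₂
  closure_eq : zariskiClosure (sumImage P₁ P₂) = zeroSet {f}

/-- The surface `f = 0` is translational. -/
def IsTranslational {K : Type*} [Field K] (f : MvPolynomial (Fin 3) K) : Prop :=
  ∃ P₁ P₂ : Fin 3 → RatFunc K, IsTranslationalParam f P₁ P₂

/-- `P` is proper: it is a birational map from the affine line to the curve it parametrizes, i.e.
its coordinates generate the field `K(t)` over `K`. -/
def IsProperParam {K : Type*} [Field K] (P : Fin 3 → RatFunc K) : Prop :=
  IntermediateField.adjoin K (Set.range P) = ⊤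

/-- `P` properly parametrizes the curve `D`: it is proper, nonconstant, and `D` is the Zariski
closure of its image. -/
def ProperlyParametrizes {K : Type*} [Field K] (P : Fin 3 → RatFunc K)
    (D : Set (Fin 3 → K)) : Prop :=
  IsProperParam P ∧ ¬ IsConstant P ∧ zariskiClosure (curveImage P) = D

/-- `Z` is an algebraic space curve: a nonempty Zariski closed subset of affine `3`-space, all of
whose irreducible components have dimension one. -/
def IsSpaceCurve {K : Type*} [Field K] (Z : Set (Fin 3 → K)) : Prop :=
  zariskiClosure Z = Z ∧ Z.Nonempty ∧
    ∀ p ∈ (vanishingIdeal K Z).minimalPrimes, ringKrullDim (MvPolynomial (Fin 3) K ⧸ p) = 1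

/-- `D` is an irreducible component of the Zariski closed set `Z`. -/
def IsComponent {K : Type*} [Field K] (D Z : Set (Fin 3 → K)) : Prop :=
  zariskiClosure D = D ∧ vanishingIdeal K D ∈ (vanishingIdeal K Z).minimalPrimes

/-- The equations `f = 0` and `a₁ f_{x₁} + a₂ f_{x₂} + a₃ f_{x₃} = 0` define a space curve, and `P`
properly parametrizes a component of it. -/
def ProperlyParametrizesPolarCurve {K : Type*} [Field K] (f : MvPolynomial (Fin 3) K)
    (a : Fin 3 → K) (P : Fin 3 → RatFunc K) : Prop :=
  IsSpaceCurve (zeroSet {f, dirDeriv a f}) ∧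
    ∃ D : Set (Fin 3 → K), IsComponent D (zeroSet {f, dirDeriv a f}) ∧ ProperlyParametrizes P D

/-- `P₁ + P₂` is a parametrization of the surface `f = 0` with `P₁`, `P₂` nonconstant and proper,
and `P₂` is defined at `0` with `P₂(0) = 0` and `P₂'(0) ≠ 0`. -/
structure IsNormalizedParam {K : Type*} [Field K] (f : MvPolynomial (Fin 3) K)
    (P₁ P₂ : Fin 3 → RatFunc K) : Prop where
  isParam : IsTranslationalParam f P₁ P₂
  proper₁ : IsProperParam P₁
  proper₂ : IsProperParam P₂
  definedAt_zero : DefinedAt P₂ 0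
  value_zero : valueAt P₂ 0 = 0
  deriv_ne_zero : derivAt P₂ 0 ≠ 0

end

/-! For fixed `s`, the curve `t ↦ P₁(s) + P₂(t)` lies on the surface and passes through `P₁(s)` at
`t = 0` with tangent vector `a = P₂'(0)`. Hence `f` and `g_a` both vanish at `P₁(s)`
(`curveImage_subset_polar`). If `f` divided `g_a`, then on each line of direction `a` the
restriction of `f` would divide its own derivative, hence be constant, and the surface would be
cylindrical (`isCylindrical_of_dvd_dirDeriv`). So `f = g_a = 0` has pure dimension one, and the
closure of the image of `P₁`, irreducible and not a point, fills a component. A normalized pair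
exists by Lüroth's theorem, a shift of the second parameter, and moving a constant vector from `P₂`
to `P₁` (`exists_isNormalizedParam`). -/

/-! ### First-order jets of rational functions and the chain rule -/

section Jets

variable {K : Type*} [Field K]

/-- The rational function `F` is defined at `s`, with value `v` and derivative `w` there. -/
def HasJet (F : RatFunc K) (s v w : K) : Prop :=
  ∃ n d : Polynomial K, d.eval s ≠ 0 ∧
    F * algebraMap (Polynomial K) (RatFunc K) d = algebraMap (Polynomial K) (RatFunc K) n ∧
    n.eval s = v * d.eval s ∧
    n.derivative.eval s = w * d.eval s + v * d.derivative.eval s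

theorem hasJet_C (c s : K) : HasJet (algebraMap K (RatFunc K) c) s c 0 :=
  ⟨Polynomial.C c, 1, by simp, by simp, by simp, by simp⟩

/-- The fraction witnessing a jet need not be reduced, so the usual formulas for sums and products
supply witnesses directly. -/
theorem HasJet.add {F G : RatFunc K} {s v w v' w' : K} (hF : HasJet F s v w)
    (hG : HasJet G s v' w') : HasJet (F + G) s (v + v') (w + w') := by
  obtain ⟨n, d, hd, h, h1, h2⟩ := hF
  obtain ⟨m, e, he, k, k1, k2⟩ := hG
  refine ⟨n * e + m * d, d * e, by simp [hd, he], ?_, ?_, ?_⟩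
  · simp only [map_add, map_mul, ← h, ← k]; ring
  · simp [h1, k1]; ring
  · simp [h1, k1, h2, k2]; ring

theorem HasJet.mul {F G : RatFunc K} {s v w v' w' : K} (hF : HasJet F s v w)
    (hG : HasJet G s v' w') : HasJet (F * G) s (v * v') (w * v' + v * w') := by
  obtain ⟨n, d, hd, h, h1, h2⟩ := hF
  obtain ⟨m, e, he, k, k1, k2⟩ := hG
  refine ⟨n * m, d * e, by simp [hd, he], ?_, ?_, ?_⟩
  · simp only [map_mul, ← h, ← k]; ring
  · simp [h1, k1]; ring
  · simp [h1, k1, h2, k2]; ring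

theorem hasJet_of_denom_ne_zero (F : RatFunc K) {s : K} (h : F.denom.eval s ≠ 0) :
    HasJet F s (F.eval (RingHom.id K) s)
      ((F.num.derivative.eval s * F.denom.eval s
        - F.num.eval s * F.denom.derivative.eval s) / F.denom.eval s ^ 2) := by
  refine ⟨F.num, F.denom, h, ?_, ?_, ?_⟩
  · nth_rw 1 [← RatFunc.num_div_denom F]
    exact div_mul_cancel₀ _ (RatFunc.algebraMap_ne_zero F.denom_ne_zero)
  · simp only [RatFunc.eval, Polynomial.eval₂_id]
    field_simp
  · simp only [RatFunc.eval, Polynomial.eval₂_id]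
    field_simp
    ring

theorem HasJet.denom_ne_zero {F : RatFunc K} {s v w : K} (hF : HasJet F s v w) :
    F.denom.eval s ≠ 0 := by
  obtain ⟨n, d, hd, h, -, -⟩ := hF
  have hd0 : d ≠ 0 := by rintro rfl; simp at hd
  have hdvd : F.denom ∣ d := by
    rw [RatFunc.denom_dvd hd0]
    exact ⟨n, by rw [← h, mul_div_cancel_right₀ _ (RatFunc.algebraMap_ne_zero hd0)]⟩
  obtain ⟨e, rfl⟩ := hdvd
  intro h0
  simp [h0] at hd

theorem HasJet.unique {F : RatFunc K} {s v w v' w' : K} (hF : HasJet F s v w)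
    (hG : HasJet F s v' w') : v = v' ∧ w = w' := by
  obtain ⟨n, d, hd, h, h1, h2⟩ := hF
  obtain ⟨m, e, he, k, k1, k2⟩ := hG
  have key : n * e = m * d := by
    apply RatFunc.algebraMap_injective K
    simp only [map_mul, ← h, ← k]; ring
  have e1 := congrArg (Polynomial.eval s) key
  have e2 := congrArg (fun p => Polynomial.eval s (Polynomial.derivative p)) key
  simp only [Polynomial.derivative_mul, Polynomial.eval_add, Polynomial.eval_mul, h1, h2, k1, k2]
    at e1 e2
  have hv : v = v' := mul_right_cancel₀ (mul_ne_zero hd he) (by linear_combination e1)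
  subst hv
  exact ⟨rfl, mul_right_cancel₀ (mul_ne_zero hd he) (by linear_combination e2)⟩

theorem hasJet_iff {P : Fin 3 → RatFunc K} {s : K} {x a : Fin 3 → K} :
    (∀ i, HasJet (P i) s (x i) (a i)) ↔ DefinedAt P s ∧ x = valueAt P s ∧ a = derivAt P s := by
  constructor
  · intro h
    have hd : DefinedAt P s := fun i => (h i).denom_ne_zero
    have := fun i => (h i).unique (hasJet_of_denom_ne_zero (P i) (hd i))
    exact ⟨hd, funext fun i => (this i).1, funext fun i => (this i).2⟩
  · rintro ⟨hd, rfl, rfl⟩ i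
    exact hasJet_of_denom_ne_zero (P i) (hd i)

theorem DefinedAt.hasJet {P : Fin 3 → RatFunc K} {s : K} (h : DefinedAt P s) (i : Fin 3) :
    HasJet (P i) s (valueAt P s i) (derivAt P s i) :=
  hasJet_iff.2 ⟨h, rfl, rfl⟩ i

theorem eval_dirDeriv_add (x a : Fin 3 → K) (p q : MvPolynomial (Fin 3) K) :
    eval x (dirDeriv a (p + q)) = eval x (dirDeriv a p) + eval x (dirDeriv a q) := by
  simp [dirDeriv, mul_add, Finset.sum_add_distrib]

theorem eval_dirDeriv_mul_X (x a : Fin 3 → K) (p : MvPolynomial (Fin 3) K) (i : Fin 3) :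
    eval x (dirDeriv a (p * X i)) = eval x (dirDeriv a p) * x i + eval x p * a i := by
  simp only [dirDeriv, Derivation.leibniz, pderiv_X, smul_eq_mul, map_sum, map_mul, map_add,
    eval_C, eval_X, mul_add, Finset.sum_add_distrib, Finset.sum_mul]
  rw [add_comm]
  congr 1
  · exact Finset.sum_congr rfl fun j _ => by ring
  · rw [Finset.sum_eq_single i]
    · simp; ring
    · intro j _ hj
      simp [hj.symm]
    · simp

/-- The chain rule. -/
theorem HasJet.aeval {P : Fin 3 → RatFunc K} {s : K} {x a : Fin 3 → K}
    (h : ∀ i, HasJet (P i) s (x i) (a i)) (p : MvPolynomial (Fin 3) K) :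
    HasJet (MvPolynomial.aeval P p) s (eval x p) (eval x (dirDeriv a p)) := by
  induction p using MvPolynomial.induction_on with
  | C c => simpa [dirDeriv] using hasJet_C c s
  | add p q hp hq =>
    rw [map_add, map_add, eval_dirDeriv_add]
    exact hp.add hq
  | mul_X p i hp =>
    rw [map_mul, map_mul, eval_dirDeriv_mul_X, aeval_X, eval_X]
    exact hp.mul (h i)

theorem infinite_setOf_definedAt [Infinite K] (P : Fin 3 → RatFunc K) :
    {s | DefinedAt P s}.Infinite := by
  have h0 : ∏ i, (P i).denom ≠ 0 := Finset.prod_ne_zero_iff.2 fun i _ => (P i).denom_ne_zero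
  refine (Polynomial.finite_setOfPred_isRoot h0).infinite_compl.mono ?_
  intro s hs i hi
  apply hs
  change (∏ i, (P i).denom).eval s = 0
  rw [Polynomial.eval_prod]
  exact Finset.prod_eq_zero (Finset.mem_univ i) hi

theorem eq_zero_of_infinite_hasJet {F : RatFunc K} {S : Set K} (hS : S.Infinite)
    (h : ∀ s ∈ S, ∃ w, HasJet F s 0 w) : F = 0 := by
  rw [← RatFunc.num_eq_zero_iff]
  refine Polynomial.eq_zero_of_infinite_isRoot _ (hS.mono fun s hs => ?_)
  obtain ⟨w, hw⟩ := h s hs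
  have := (hw.unique (hasJet_of_denom_ne_zero F hw.denom_ne_zero)).1
  have hd := hw.denom_ne_zero
  simp only [RatFunc.eval, Polynomial.eval₂_id] at this
  simpa [hd] using this.symm

theorem mem_vanishingIdeal_curveImage [Infinite K] {P : Fin 3 → RatFunc K}
    {p : MvPolynomial (Fin 3) K} :
    p ∈ vanishingIdeal K (curveImage P) ↔ aeval P p = 0 := by
  constructor
  · intro h
    refine eq_zero_of_infinite_hasJet (infinite_setOf_definedAt P) fun s hs => ?_
    have h0 : eval (valueAt P s) p = 0 := h _ ⟨s, hs, rfl⟩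
    exact ⟨_, h0 ▸ HasJet.aeval hs.hasJet p⟩
  · rintro h x ⟨s, hs, rfl⟩
    have := HasJet.aeval hs.hasJet p
    rw [h] at this
    simpa using (this.unique (by simpa using hasJet_C (0 : K) s)).1

/-- Being the kernel of a map to a field, this ideal is prime: parametrized curves are irreducible.
-/
theorem vanishingIdeal_curveImage [Infinite K] (P : Fin 3 → RatFunc K) :
    vanishingIdeal K (curveImage P) = RingHom.ker (aeval P : MvPolynomial (Fin 3) K →ₐ[K] _) :=
  Ideal.ext fun _ => mem_vanishingIdeal_curveImage

theorem vanishingIdeal_zariskiClosure (S : Set (Fin 3 → K)) :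
    vanishingIdeal K (zariskiClosure S) = vanishingIdeal K S :=
  zeroLocus_vanishingIdeal_galoisConnection.u_l_u_eq_u S

theorem zariskiClosure_zeroSet (S : Set (MvPolynomial (Fin 3) K)) :
    zariskiClosure (zeroSet S) = zeroSet S := by
  have : zeroSet S = zeroLocus K (Ideal.span S) := (zeroLocus_span S).symm
  rw [this]
  exact zeroLocus_vanishingIdeal_galoisConnection.l_u_l_eq_l (Ideal.span S)

theorem zariskiClosure_idem (S : Set (Fin 3 → K)) :
    zariskiClosure (zariskiClosure S) = zariskiClosure S := by
  conv_lhs => rw [zariskiClosure, vanishingIdeal_zariskiClosure]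
  rfl

theorem subset_zariskiClosure (S : Set (Fin 3 → K)) : S ⊆ zariskiClosure S :=
  zeroLocus_vanishingIdeal_le S

end Jets

/-! ### Tangency and the non-cylindrical hypothesis -/

section Polar

variable {K : Type*} [Field K]

/-- The rational function `f(c + P(t))` has infinitely many zeros, so it is zero and so is its jet
at `s`; the chain rule computes that jet. -/
theorem eval_add_valueAt_eq_zero_and_dirDeriv {f : MvPolynomial (Fin 3) K} {P : Fin 3 → RatFunc K}
    [Infinite K] {c : Fin 3 → K} {s : K} (hs : DefinedAt P s)
    (h : ∀ t, DefinedAt P t → eval (c + valueAt P t) f = 0) :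
    eval (c + valueAt P s) f = 0 ∧ eval (c + valueAt P s) (dirDeriv (derivAt P s) f) = 0 := by
  have key : ∀ t, DefinedAt P t → ∀ i, HasJet (algebraMap K (RatFunc K) (c i) + P i) t
      ((c + valueAt P t) i) (derivAt P t i) := fun t ht i => by
    simpa using (hasJet_C (c i) t).add (ht.hasJet i)
  have h0 : MvPolynomial.aeval (fun i => algebraMap K (RatFunc K) (c i) + P i) f = 0 :=
    eq_zero_of_infinite_hasJet (infinite_setOf_definedAt P) fun t ht =>
      ⟨_, h t ht ▸ HasJet.aeval (key t ht) f⟩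
  have := HasJet.aeval (key s hs) f
  rw [h0] at this
  exact this.unique (by simpa using hasJet_C (0 : K) s)

theorem curveImage_subset_polar [Infinite K] {f : MvPolynomial (Fin 3) K}
    {P₁ P₂ : Fin 3 → RatFunc K} (h : IsNormalizedParam f P₁ P₂) :
    curveImage P₁ ⊆ zeroSet {f, dirDeriv (derivAt P₂ 0) f} := by
  rintro _ ⟨s, hs, rfl⟩
  have := eval_add_valueAt_eq_zero_and_dirDeriv (f := f) (c := valueAt P₁ s) h.definedAt_zero fun t ht => by
    have : valueAt P₁ s + valueAt P₂ t ∈ zeroSet {f} :=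
      h.isParam.closure_eq ▸ subset_zariskiClosure _ ⟨s, t, hs, ht, rfl⟩
    exact this f rfl
  rw [h.value_zero, add_zero] at this
  simpa [zeroSet] using this

theorem derivative_aeval_line (x a : Fin 3 → K) (p : MvPolynomial (Fin 3) K) :
    Polynomial.derivative
      (aeval (fun i => Polynomial.C (x i) + Polynomial.C (a i) * Polynomial.X) p) =
    aeval (fun i => Polynomial.C (x i) + Polynomial.C (a i) * Polynomial.X) (dirDeriv a p) := by
  induction p using MvPolynomial.induction_on with
  | C c => simp [dirDeriv]
  | add p q hp hq =>
    rw [map_add, map_add, hp, hq]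
    simp [dirDeriv, mul_add, Finset.sum_add_distrib]
  | mul_X p i hp =>
    rw [map_mul, Polynomial.derivative_mul, hp]
    simp only [dirDeriv, Derivation.leibniz, pderiv_X, smul_eq_mul, map_sum, map_mul, map_add,
      aeval_X, mul_add, Finset.sum_add_distrib]
    rw [add_comm]
    congr 1
    · rw [Finset.sum_eq_single i]
      · simp [← MvPolynomial.algebraMap_eq]; ring
      · intro j _ hj
        simp [hj.symm]
      · simp
    · simp only [Finset.sum_mul]
      rw [← Finset.sum_add_distrib]
      exact Finset.sum_congr rfl fun j _ => by ring

theorem isCylindrical_of_dvd_dirDeriv [CharZero K] {f : MvPolynomial (Fin 3) K} {a : Fin 3 → K}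
    (ha : a ≠ 0) (h : f ∣ dirDeriv a f) : IsCylindrical f := by
  refine ⟨a, ha, fun x hx t => ?_⟩
  set L : MvPolynomial (Fin 3) K →ₐ[K] Polynomial K :=
    aeval (fun i => Polynomial.C (x i) + Polynomial.C (a i) * Polynomial.X) with hL
  have heval : ∀ t, (L f).eval t = eval (x + t • a) f := fun t => by
    have : ((Polynomial.aeval t : Polynomial K →ₐ[K] K).comp L) = aeval (x + t • a) := by
      ext i; simp [hL]; ring
    simpa [Polynomial.coe_aeval_eq_eval] using DFunLike.congr_fun this f
  have hd : L f ∣ Polynomial.derivative (L f) := by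
    rw [hL, derivative_aeval_line]
    exact map_dvd L h
  -- A nonzero derivative has smaller degree than `L f`, so `L f` cannot divide it.
  have h0 : Polynomial.derivative (L f) = 0 := by
    by_contra hne
    have hf0 : L f ≠ 0 := fun h => hne (by simp [h])
    exact (Polynomial.degree_derivative_lt hf0).not_ge (Polynomial.degree_le_of_dvd hd hne)
  rw [← heval, Polynomial.eq_C_of_derivative_eq_zero h0, Polynomial.eval_C,
    Polynomial.coeff_zero_eq_eval_zero, heval]
  simpa using hx

end Polar

/-! ### Dimension of the polar curve -/

section Dimension

theorem ringKrullDim_quotient_add_one_le {R : Type*} [CommRing R] {p q : Ideal R} [p.IsPrime]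
    (h : p < q) : ringKrullDim (R ⧸ q) + 1 ≤ ringKrullDim (R ⧸ p) := by
  obtain ⟨r, hrq, hrp⟩ := SetLike.exists_of_lt h
  refine ringKrullDim_succ_le_of_surjective (Ideal.Quotient.factor h.le)
    (Ideal.Quotient.factor_surjective h.le) (r := Ideal.Quotient.mk p r) ?_ ?_
  · exact mem_nonZeroDivisors_of_ne_zero (by rwa [Ne, Ideal.Quotient.eq_zero_iff_mem])
  · rw [Ideal.Quotient.factor_mk, Ideal.Quotient.eq_zero_iff_mem]
    exact hrq

theorem ringKrullDim_quotient_nonneg {R : Type*} [CommRing R] (p : Ideal R) [p.IsPrime] :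
    0 ≤ ringKrullDim (R ⧸ p) :=
  ringKrullDim_nonneg_of_nontrivial

theorem one_le_ringKrullDim_quotient {R : Type*} [CommRing R] {p : Ideal R} [p.IsPrime]
    (h : ¬ p.IsMaximal) : 1 ≤ ringKrullDim (R ⧸ p) := by
  obtain ⟨m, hm, hpm⟩ := p.exists_le_maximal Ideal.IsPrime.ne_top'
  have hlt : p < m := lt_of_le_of_ne hpm (by rintro rfl; exact h hm)
  refine le_trans ?_ (ringKrullDim_quotient_add_one_le hlt)
  simpa using add_le_add_left (ringKrullDim_quotient_nonneg m) 1

theorem le_one_of_add_one_le_of_add_one_le_three {d e : WithBot ℕ∞} (h : d + 1 ≤ e)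
    (h' : e + 1 ≤ 3) : d ≤ 1 := by
  have h3 : d + 1 + 1 ≤ 3 := le_trans (by gcongr) h'
  induction d with
  | bot => exact bot_le
  | coe d =>
    have h4 : d + 1 + 1 ≤ 3 := WithBot.coe_le_coe.1 h3
    induction d with
    | top => simp at h4
    | coe d => norm_cast at h4 ⊢; omega

variable {K : Type*} [Field K]

/-- The automorphism of the polynomial ring induced by the translation by `c`. -/
noncomputable def translateEquiv (c : Fin 3 → K) :
    MvPolynomial (Fin 3) K ≃ₐ[K] MvPolynomial (Fin 3) K :=
  AlgEquiv.ofAlgHom (aeval fun i => X i + C (c i)) (aeval fun i => X i - C (c i))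
    (by ext i; simp [← MvPolynomial.algebraMap_eq]) (by ext i; simp [← MvPolynomial.algebraMap_eq])

theorem aeval_translateEquiv {A : Type*} [CommRing A] [Algebra K A] (c : Fin 3 → K)
    (u : Fin 3 → A) (p : MvPolynomial (Fin 3) K) :
    aeval u (translateEquiv c p) = aeval (fun i => u i + algebraMap K A (c i)) p := by
  have : (aeval u).comp (translateEquiv c : MvPolynomial (Fin 3) K →ₐ[K] _) =
      aeval (fun i => u i + algebraMap K A (c i)) := by
    ext i; simp [translateEquiv]
  exact DFunLike.congr_fun this p

theorem eval_translateEquiv (c x : Fin 3 → K) (p : MvPolynomial (Fin 3) K) :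
    eval x (translateEquiv c p) = eval (x + c) p :=
  aeval_translateEquiv c x p

theorem height_vanishingIdeal_singleton_eq (x y : Fin 3 → K) :
    (vanishingIdeal K {x}).height = (vanishingIdeal K {y}).height := by
  have : vanishingIdeal K {x} = (vanishingIdeal K {y}).comap
      (translateEquiv (x - y)).toRingEquiv := by
    ext p
    rw [Ideal.mem_comap, mem_vanishingIdeal_singleton_iff, mem_vanishingIdeal_singleton_iff]
    change _ ↔ aeval y (translateEquiv (x - y) p) = 0
    rw [aeval_translateEquiv]
    simp
  rw [this, RingEquiv.height_comap]

theorem ringKrullDim_mvPolynomial_three : ringKrullDim (MvPolynomial (Fin 3) K) = 3 := by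
  simp

/-- Some maximal ideal attains the dimension 3. By the Nullstellensatz maximal ideals are points,
and translations permute the points transitively. -/
theorem height_eq_three_of_isMaximal [IsAlgClosed K] (m : Ideal (MvPolynomial (Fin 3) K))
    [hm : m.IsMaximal] : m.height = 3 := by
  have : FiniteRingKrullDim (MvPolynomial (Fin 3) K) := by
    rw [finiteRingKrullDim_iff_ne_bot_and_top, ringKrullDim_mvPolynomial_three]
    exact ⟨by decide, by decide⟩
  obtain ⟨m', hm', h⟩ := Ideal.exists_isMaximal_height (R := MvPolynomial (Fin 3) K)
  obtain ⟨x, rfl⟩ := isMaximal_iff_eq_vanishingIdeal_singleton.1 hm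
  obtain ⟨y, rfl⟩ := isMaximal_iff_eq_vanishingIdeal_singleton.1 hm'
  rw [ringKrullDim_mvPolynomial_three] at h
  rw [height_vanishingIdeal_singleton_eq x y]
  exact WithBot.coe_injective h

/-- Two polynomials in three variables, the first irreducible and not dividing the second,
define a curve. -/
theorem ringKrullDim_quotient_eq_one_of_mem_minimalPrimes [IsAlgClosed K]
    {f g : MvPolynomial (Fin 3) K} (hf : Irreducible f) (hfg : ¬ f ∣ g)
    {p : Ideal (MvPolynomial (Fin 3) K)} (hp : p ∈ (Ideal.span {f, g}).minimalPrimes) :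
    ringKrullDim (MvPolynomial (Fin 3) K ⧸ p) = 1 := by
  classical
  have := hp.1.1
  have hfp : f ∈ p := hp.1.2 (Ideal.subset_span (by simp))
  have hgp : g ∈ p := hp.1.2 (Ideal.subset_span (by simp))
  have hprime : (Ideal.span {f}).IsPrime :=
    (Ideal.span_singleton_prime hf.ne_zero).2 hf.prime
  have h2 : Ideal.span {f} < p :=
    lt_of_le_of_ne ((Ideal.span_singleton_le_iff_mem p).2 hfp) fun h =>
      hfg (Ideal.mem_span_singleton.1 (h ▸ hgp))
  apply le_antisymm
  -- Each step of the chain `0 < (f) < p` lowers the dimension 3 of the quotient by at least one.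
  · have e1 := ringKrullDim_quotient_succ_le_of_nonZeroDivisor
      (mem_nonZeroDivisors_of_ne_zero hf.ne_zero)
    have e2 := ringKrullDim_quotient_add_one_le h2
    rw [ringKrullDim_mvPolynomial_three] at e1
    exact le_one_of_add_one_le_of_add_one_le_three e2 e1
  · refine one_le_ringKrullDim_quotient fun hm => ?_
    -- Krull's height theorem bounds the height of `p` by 2, whereas a maximal ideal has height 3.
    have e1 := Ideal.height_le_card_of_mem_minimalPrimes_span_finset (s := {f, g}) (p := p)
      (by simpa using hp)
    rw [height_eq_three_of_isMaximal] at e1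
    have e2 : (3 : ℕ∞) ≤ 2 := e1.trans (by exact_mod_cast Finset.card_le_two)
    exact absurd e2 (by decide)

theorem not_isMaximal_vanishingIdeal_curveImage [IsAlgClosed K] {P : Fin 3 → RatFunc K}
    (h : ¬ IsConstant P) : ¬ (vanishingIdeal K (curveImage P)).IsMaximal := by
  have := IsAlgClosed.instInfinite (K := K)
  intro hm
  obtain ⟨x, hx⟩ := isMaximal_iff_eq_vanishingIdeal_singleton.1 hm
  refine h ⟨x, fun i => ?_⟩
  have : X i - C (x i) ∈ vanishingIdeal K (curveImage P) := by
    rw [hx, mem_vanishingIdeal_singleton_iff]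
    simp
  rw [mem_vanishingIdeal_curveImage] at this
  simpa [sub_eq_zero] using this

theorem properlyParametrizesPolarCurve_of_isNormalizedParam [IsAlgClosed K] [CharZero K]
    {f : MvPolynomial (Fin 3) K} (hf : Irreducible f) (hcyl : ¬ IsCylindrical f)
    {P₁ P₂ : Fin 3 → RatFunc K} (h : IsNormalizedParam f P₁ P₂) :
    ProperlyParametrizesPolarCurve f (derivAt P₂ 0) P₁ := by
  set g := dirDeriv (derivAt P₂ 0) f with hg
  have hfg : ¬ f ∣ g := fun hd => hcyl (isCylindrical_of_dvd_dirDeriv h.deriv_ne_zero hd)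
  have hsub : curveImage P₁ ⊆ zeroSet {f, g} := curveImage_subset_polar h
  have hmin : (vanishingIdeal K (zeroSet {f, g})).minimalPrimes =
      (Ideal.span {f, g}).minimalPrimes := by
    have : zeroSet {f, g} = zeroLocus K (Ideal.span {f, g}) := (zeroLocus_span {f, g}).symm
    rw [this, vanishingIdeal_zeroLocus_eq_radical, Ideal.radical_minimalPrimes]
  have hdim : ∀ p ∈ (vanishingIdeal K (zeroSet {f, g})).minimalPrimes,
      ringKrullDim (MvPolynomial (Fin 3) K ⧸ p) = 1 := fun p hp =>
    ringKrullDim_quotient_eq_one_of_mem_minimalPrimes hf hfg (hmin ▸ hp)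
  obtain ⟨s, hs⟩ := (infinite_setOf_definedAt P₁).nonempty
  refine ⟨⟨zariskiClosure_zeroSet _, ⟨valueAt P₁ s, hsub ⟨s, hs, rfl⟩⟩, hdim⟩,
    zariskiClosure (curveImage P₁), ⟨zariskiClosure_idem _, ?_⟩, h.proper₁,
    h.isParam.nonconst₁, rfl⟩
  rw [vanishingIdeal_zariskiClosure]
  have hprime : (vanishingIdeal K (curveImage P₁)).IsPrime := by
    rw [vanishingIdeal_curveImage]
    exact RingHom.ker_isPrime _
  -- If the component ideal `p` were strictly smaller, its quotient would have dimension at least 2,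
  -- since that of the curve of `P₁` is at least 1.
  obtain ⟨p, hp, hple⟩ := Ideal.exists_minimalPrimes_le (vanishingIdeal_anti_mono (k := K) hsub)
  rcases hple.eq_or_lt with rfl | hlt
  · exact hp
  · have := hp.1.1
    have e := ringKrullDim_quotient_add_one_le hlt
    have e' := one_le_ringKrullDim_quotient
      (not_isMaximal_vanishingIdeal_curveImage h.isParam.nonconst₁)
    rw [hdim p hp] at e
    have : (1 : WithBot ℕ∞) + 1 ≤ 1 := le_trans (by gcongr) e
    exact absurd this (by decide)

end Dimension

/-! ### Existence of a normalized pair -/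

section Normalization

variable {K : Type*} [Field K]

theorem isConstant_comp_iff (φ : RatFunc K →ₐ[K] RatFunc K) (P : Fin 3 → RatFunc K) :
    IsConstant (fun i => φ (P i)) ↔ IsConstant P := by
  refine exists_congr fun c => forall_congr' fun i => ?_
  have : φ (RatFunc.C (c i)) = RatFunc.C (c i) := φ.commutes (c i)
  conv_lhs => rw [← this]
  exact φ.injective.eq_iff

/-- Substitution may change the set of points reached, but `φ` is injective, so the polynomial
relations between the coordinates stay the same. -/
theorem vanishingIdeal_curveImage_comp [Infinite K] (φ : RatFunc K →ₐ[K] RatFunc K)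
    (P : Fin 3 → RatFunc K) :
    vanishingIdeal K (curveImage fun i => φ (P i)) = vanishingIdeal K (curveImage P) := by
  ext p
  rw [mem_vanishingIdeal_curveImage, mem_vanishingIdeal_curveImage]
  have : aeval (fun i => φ (P i)) = φ.comp (aeval P : MvPolynomial (Fin 3) K →ₐ[K] _) := by
    ext i; simp
  rw [this, AlgHom.comp_apply, map_eq_zero_iff φ φ.injective]

/-- Viewing the surface as a family of translates of one curve lets each parameter be changed
separately. -/
theorem mem_vanishingIdeal_sumImage {P₁ P₂ : Fin 3 → RatFunc K} {p : MvPolynomial (Fin 3) K} :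
    p ∈ vanishingIdeal K (sumImage P₁ P₂) ↔
      ∀ s, DefinedAt P₁ s → translateEquiv (valueAt P₁ s) p ∈ vanishingIdeal K (curveImage P₂) := by
  constructor
  · rintro h s hs _ ⟨t, ht, rfl⟩
    have : eval (valueAt P₁ s + valueAt P₂ t) p = 0 := h _ ⟨s, t, hs, ht, rfl⟩
    change eval _ _ = 0
    rwa [eval_translateEquiv, add_comm]
  · rintro h _ ⟨s, t, hs, ht, rfl⟩
    have : eval (valueAt P₂ t) (translateEquiv (valueAt P₁ s) p) = 0 := h s hs _ ⟨t, ht, rfl⟩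
    rw [eval_translateEquiv, add_comm] at this
    exact this

theorem sumImage_comm (P₁ P₂ : Fin 3 → RatFunc K) : sumImage P₁ P₂ = sumImage P₂ P₁ := by
  ext x
  constructor <;> rintro ⟨s, t, hs, ht, rfl⟩ <;> exact ⟨t, s, ht, hs, add_comm _ _⟩

theorem zariskiClosure_sumImage_comp_right [Infinite K] (φ : RatFunc K →ₐ[K] RatFunc K)
    (P₁ P₂ : Fin 3 → RatFunc K) :
    zariskiClosure (sumImage P₁ fun i => φ (P₂ i)) = zariskiClosure (sumImage P₁ P₂) := by
  have : vanishingIdeal K (sumImage P₁ fun i => φ (P₂ i)) = vanishingIdeal K (sumImage P₁ P₂) := by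
    ext p
    simp only [mem_vanishingIdeal_sumImage, vanishingIdeal_curveImage_comp]
  rw [zariskiClosure, this, zariskiClosure]

theorem isTranslationalParam_comp_iff [Infinite K] (φ ψ : RatFunc K →ₐ[K] RatFunc K)
    {f : MvPolynomial (Fin 3) K} {P₁ P₂ : Fin 3 → RatFunc K} :
    IsTranslationalParam f (fun i => φ (P₁ i)) (fun i => ψ (P₂ i)) ↔
      IsTranslationalParam f P₁ P₂ := by
  have : zariskiClosure (sumImage (fun i => φ (P₁ i)) fun i => ψ (P₂ i)) =
      zariskiClosure (sumImage P₁ P₂) := by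
    rw [zariskiClosure_sumImage_comp_right, sumImage_comm, zariskiClosure_sumImage_comp_right,
      sumImage_comm]
  constructor
  · rintro ⟨h₁, h₂, h₃⟩
    exact ⟨by rwa [isConstant_comp_iff] at h₁, by rwa [isConstant_comp_iff] at h₂,
      this ▸ h₃⟩
  · rintro ⟨h₁, h₂, h₃⟩
    exact ⟨by rwa [isConstant_comp_iff], by rwa [isConstant_comp_iff], this.trans h₃⟩

theorem isProperParam_comp (e : RatFunc K ≃ₐ[K] RatFunc K) {P : Fin 3 → RatFunc K}
    (h : IsProperParam P) : IsProperParam fun i => e (P i) := by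
  have hr : Set.range (fun i => e (P i)) = (e : RatFunc K →ₐ[K] RatFunc K) '' Set.range P := by
    rw [← Set.range_comp]; rfl
  rw [IsProperParam, hr, ← IntermediateField.adjoin_map,
    show IntermediateField.adjoin K _ = ⊤ from h,
    ← AlgHom.fieldRange_eq_map]
  exact AlgHom.fieldRange_eq_top.2 e.surjective

/-- Lüroth's theorem: every nonconstant parametrization factors through a proper one. -/
theorem exists_isProperParam {P : Fin 3 → RatFunc K} (h : ¬ IsConstant P) :
    ∃ (φ : RatFunc K →ₐ[K] RatFunc K) (Q : Fin 3 → RatFunc K),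
      IsProperParam Q ∧ P = fun i => φ (Q i) := by
  set E := IntermediateField.adjoin K (Set.range P) with hE
  have hmem : ∀ i, P i ∈ E := fun i => IntermediateField.subset_adjoin K _ ⟨i, rfl⟩
  have hne : E ≠ ⊥ := fun hbot => h (by
    have : ∀ i, ∃ c : K, RatFunc.C c = P i := fun i => by
      have := hmem i
      rwa [hbot, IntermediateField.mem_bot] at this
    choose c hc using this
    exact ⟨c, fun i => (hc i).symm⟩)
  let e := RatFunc.Luroth.algEquiv hne
  let φ : RatFunc K →ₐ[K] RatFunc K := E.val.comp (e : RatFunc K →ₐ[K] E)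
  let Q : Fin 3 → RatFunc K := fun i => e.symm ⟨P i, hmem i⟩
  have hφQ : ∀ i, φ (Q i) = P i := fun i => by simp [φ, Q]
  refine ⟨φ, Q, ?_, funext fun i => (hφQ i).symm⟩
  -- Properness of `Q` can be tested after applying `φ`, where both sides become `E`.
  apply IntermediateField.map_injective φ
  have hr : φ '' Set.range Q = Set.range P := by
    rw [← Set.range_comp]
    exact congrArg Set.range (funext hφQ)
  rw [IntermediateField.adjoin_map, hr, ← AlgHom.fieldRange_eq_map, ← hE]
  ext x
  rw [AlgHom.mem_fieldRange]
  constructor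
  · intro hx
    exact ⟨e.symm ⟨x, hx⟩, by simp [φ]⟩
  · rintro ⟨y, rfl⟩
    exact (e y).2

/-- The automorphism `t ↦ t + c` of the field of rational functions. -/
noncomputable def shiftEquiv (c : K) : RatFunc K ≃ₐ[K] RatFunc K :=
  IsFractionRing.algEquivOfAlgEquiv (Polynomial.algEquivAevalXAddC c)

theorem HasJet.shift {F : RatFunc K} {c v w : K} (h : HasJet F c v w) :
    HasJet (shiftEquiv c F) 0 v w := by
  obtain ⟨n, d, hd, h, h1, h2⟩ := h
  have hmap : ∀ p : Polynomial K, shiftEquiv c (algebraMap _ _ p) =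
      algebraMap _ (RatFunc K) (p.comp (Polynomial.X + Polynomial.C c)) := fun p => by
    simp only [shiftEquiv, IsFractionRing.algEquivOfAlgEquiv_algebraMap]
    rfl
  refine ⟨n.comp (Polynomial.X + Polynomial.C c), d.comp (Polynomial.X + Polynomial.C c),
    by simpa using hd, ?_, by simpa using h1, by simpa [Polynomial.derivative_comp] using h2⟩
  rw [← hmap, ← hmap, ← map_mul, h]

theorem hasJet_add_const_iff {F : RatFunc K} {s v w c : K} :
    HasJet (F + algebraMap K (RatFunc K) c) s (v + c) w ↔ HasJet F s v w := by
  constructor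
  · intro h
    simpa using h.add (hasJet_C (-c) s)
  · intro h
    simpa using h.add (hasJet_C c s)

theorem definedAt_add_const {P : Fin 3 → RatFunc K} {s : K} (c : Fin 3 → K) (h : DefinedAt P s) :
    DefinedAt (fun i => P i + algebraMap K (RatFunc K) (c i)) s ∧
      valueAt (fun i => P i + algebraMap K (RatFunc K) (c i)) s = valueAt P s + c ∧
      derivAt (fun i => P i + algebraMap K (RatFunc K) (c i)) s = derivAt P s := by
  obtain ⟨h₁, h₂, h₃⟩ := hasJet_iff.1 fun i => hasJet_add_const_iff (c := c i) |>.2 (h.hasJet i)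
  exact ⟨h₁, h₂.symm, h₃.symm⟩

theorem sumImage_subset_add_const (P₁ P₂ : Fin 3 → RatFunc K) (c : Fin 3 → K) :
    sumImage P₁ P₂ ⊆ sumImage (fun i => P₁ i + algebraMap K (RatFunc K) (c i))
      (fun i => P₂ i + algebraMap K (RatFunc K) ((-c) i)) := by
  rintro _ ⟨s, t, hs, ht, rfl⟩
  obtain ⟨hs₁, hs₂, -⟩ := definedAt_add_const c hs
  obtain ⟨ht₁, ht₂, -⟩ := definedAt_add_const (-c) ht
  exact ⟨s, t, hs₁, ht₁, by rw [hs₂, ht₂]; abel⟩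

theorem sumImage_add_const (P₁ P₂ : Fin 3 → RatFunc K) (c : Fin 3 → K) :
    sumImage (fun i => P₁ i + algebraMap K (RatFunc K) (c i))
      (fun i => P₂ i + algebraMap K (RatFunc K) ((-c) i)) = sumImage P₁ P₂ := by
  refine subset_antisymm ?_ (sumImage_subset_add_const P₁ P₂ c)
  simpa [add_assoc] using sumImage_subset_add_const
    (fun i => P₁ i + algebraMap K (RatFunc K) (c i))
    (fun i => P₂ i + algebraMap K (RatFunc K) ((-c) i)) (-c)

theorem isConstant_of_isConstant_add_const {P : Fin 3 → RatFunc K} {c : Fin 3 → K}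
    (h : IsConstant fun i => P i + algebraMap K (RatFunc K) (c i)) : IsConstant P := by
  obtain ⟨d, hd⟩ := h
  refine ⟨d - c, fun i => ?_⟩
  rw [Pi.sub_apply, map_sub, ← hd i]
  exact (add_sub_cancel_right _ _).symm

theorem isProperParam_add_const {P : Fin 3 → RatFunc K} (c : Fin 3 → K) (h : IsProperParam P) :
    IsProperParam fun i => P i + algebraMap K (RatFunc K) (c i) := by
  rw [IsProperParam, ← top_le_iff, ← show IntermediateField.adjoin K _ = ⊤ from h,
    IntermediateField.adjoin_le_iff]
  rintro _ ⟨i, rfl⟩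
  have : P i = (P i + algebraMap K (RatFunc K) (c i)) - algebraMap K (RatFunc K) (c i) := by ring
  rw [this]
  exact sub_mem (IntermediateField.subset_adjoin K _ ⟨i, rfl⟩)
    (IntermediateField.algebraMap_mem _ _)

theorem eq_C_of_wronskian_eq_zero [CharZero K] {F : RatFunc K}
    (h : F.num.derivative * F.denom - F.num * F.denom.derivative = 0) :
    ∃ c, F = RatFunc.C c := by
  rw [sub_eq_zero] at h
  -- Coprimality of numerator and denominator gives this divisibility; by degrees the denominator is
  -- then constant, and so is the numerator.
  have hdvd : F.denom ∣ F.denom.derivative :=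
    F.isCoprime_num_denom.symm.dvd_of_dvd_mul_left ⟨F.num.derivative, by rw [← h, mul_comm]⟩
  have hd : F.denom.derivative = 0 := by
    by_contra hne
    exact (Polynomial.degree_derivative_lt F.denom_ne_zero).not_ge
      (Polynomial.degree_le_of_dvd hdvd hne)
  have hn : F.num.derivative = 0 := by
    rw [hd, mul_zero] at h
    exact (mul_eq_zero.1 h).resolve_right F.denom_ne_zero
  refine ⟨F.num.coeff 0 / F.denom.coeff 0, ?_⟩
  nth_rw 1 [← RatFunc.num_div_denom F, Polynomial.eq_C_of_derivative_eq_zero hd,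
    Polynomial.eq_C_of_derivative_eq_zero hn]
  rw [map_div₀, RatFunc.algebraMap_C, RatFunc.algebraMap_C]

theorem exists_definedAt_derivAt_ne_zero [CharZero K] {P : Fin 3 → RatFunc K}
    (h : ¬ IsConstant P) : ∃ s, DefinedAt P s ∧ derivAt P s ≠ 0 := by
  obtain ⟨i, hi⟩ : ∃ i, (P i).num.derivative * (P i).denom
      - (P i).num * (P i).denom.derivative ≠ 0 := by
    by_contra! hall
    choose c hc using fun i => eq_C_of_wronskian_eq_zero (hall i)
    exact h ⟨c, hc⟩
  obtain ⟨s, hs, hs'⟩ := (infinite_setOf_definedAt P).exists_notMem_finite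
    (Polynomial.finite_setOfPred_isRoot hi)
  refine ⟨s, hs, fun h0 => hs' ?_⟩
  have := congrFun h0 i
  simpa [derivAt, hs i, Polynomial.IsRoot.def] using this

theorem exists_isNormalizedParam [CharZero K] {f : MvPolynomial (Fin 3) K}
    (h : IsTranslational f) : ∃ P₁ P₂ : Fin 3 → RatFunc K, IsNormalizedParam f P₁ P₂ := by
  obtain ⟨R₁, R₂, hR⟩ := h
  obtain ⟨φ, Q₁, hQ₁, rfl⟩ := exists_isProperParam hR.nonconst₁
  obtain ⟨ψ, Q₂, hQ₂, rfl⟩ := exists_isProperParam hR.nonconst₂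
  rw [isTranslationalParam_comp_iff] at hR
  obtain ⟨s, hs, hs'⟩ := exists_definedAt_derivAt_ne_zero hR.nonconst₂
  set c := valueAt Q₂ s
  -- The shift moves the parameter `s`, where the derivative is nonzero, to 0; subtracting `c` then
  -- makes the value there 0, and adding `c` to `Q₁` preserves the sum.
  have hR' := (isTranslationalParam_comp_iff (AlgHom.id K _)
    (shiftEquiv s : RatFunc K →ₐ[K] RatFunc K)).2 hR
  obtain ⟨h₁, h₂, h₃⟩ := hasJet_iff.1 fun i => (hs.hasJet i).shift
  obtain ⟨k₁, k₂, k₃⟩ := definedAt_add_const (-c) h₁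
  refine ⟨fun i => Q₁ i + algebraMap K (RatFunc K) (c i),
    fun i => shiftEquiv s (Q₂ i) + algebraMap K (RatFunc K) ((-c) i),
    ⟨fun h => hR.nonconst₁ (isConstant_of_isConstant_add_const h),
      fun h => hR'.nonconst₂ (isConstant_of_isConstant_add_const h), ?_⟩,
    isProperParam_add_const c hQ₁, isProperParam_add_const _ (isProperParam_comp _ hQ₂), k₁, ?_, ?_⟩
  · rw [sumImage_add_const]
    exact hR'.closure_eq
  · rw [k₂, ← h₂, add_neg_cancel]
  · rw [k₃, ← h₃]
    exact hs'

end Normalization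

theorem theorem1 {K : Type*} [Field K] [IsAlgClosed K] [CharZero K]
    (f : MvPolynomial (Fin 3) K) (hf : Irreducible f)
    (hcyl : ¬ IsCylindrical f) (htr : IsTranslational f) :
    (∃ a : Fin 3 → K, a ≠ 0 ∧ ∃ P₁ P₂ : Fin 3 → RatFunc K,
      IsNormalizedParam f P₁ P₂ ∧ a = derivAt P₂ 0 ∧
      ProperlyParametrizesPolarCurve f a P₁) ∧
    (∀ P₁ P₂ : Fin 3 → RatFunc K, IsNormalizedParam f P₁ P₂ →
      ProperlyParametrizesPolarCurve f (derivAt P₂ 0) P₁) := by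
  have key : ∀ P₁ P₂ : Fin 3 → RatFunc K, IsNormalizedParam f P₁ P₂ →
      ProperlyParametrizesPolarCurve f (derivAt P₂ 0) P₁ := fun P₁ P₂ h =>
    properlyParametrizesPolarCurve_of_isNormalizedParam hf hcyl h
  obtain ⟨P₁, P₂, h⟩ := exists_isNormalizedParam htr
  exact ⟨⟨derivAt P₂ 0, h.deriv_ne_zero, P₁, P₂, h, rfl, key P₁ P₂ h⟩, key⟩
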